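/- Let $k,q\ge 1$ be integers and let $W_{k,q}=\{\mathbf v\in\mathbb Z^{k-1}: 0\le v_1\le v_2\le\cdots\le v_{k-1}\le q\}$. A permutation $\pi=\pi_1\pi_2\ldots\pi_{k-1}$ of $\{1,\ldots,k-1\}$ is \emph{consistent} with $\mathbf v\in W_{k,q}$ if $i$ stands before $i+1$ in $\pi$ whenever $v_i=v_{i+1}$. The \emph{edgewise subdivision} $T_{k,q}$ of the simplex $\{\mathbf x\in\mathbb R^{k-1}:0\le x_1\le\cdots\le x_{k-1}\le q\}$ is the simplicial complex whose facets are the simplices with vertex sets $$F(\mathbf v,\pi)=\{\mathbf v^{(1)},\ldots,\mathbf v^{(k)}\},\qquad \mathbf v^{(j+1)}=\mathbf v+e_{\pi_{k-1}}+e_{\pi_{k-2}}+\cdots+e_{\pi_{k-j}}\quad(0\le j\le k-1),$$ where $\mathbf v\in W_{k,q}$, $\pi$ is consistent with $\mathbf v$, and $F(\mathbf v,\pi)\subseteq W_{k,q}$. For a $d$-dimensional simplicial complex $K$ with $f_i$ faces of dimension $i$ ($f_{-1}=1$), the $h$-vector $(h_0,\ldots,h_{d+1})$ is defined by $$h_s(K)=\sum_{i=0}^{s}(-1)^{s-i}\binom{d+1-i}{d+1-s}f_{i-1}.$$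 \textbf{Theorem.} The entries of the $h$-vector of $T_{k,q}$ (which has dimension $k-1$) are, for $0\le i\le k$, $$h_i(T_{k,q})=\sum_{j=0}^{i}(-1)^j\binom{k}{j}\binom{(i-j)q+k-1}{k-1}.$$ -/

import Mathlib

/-! ### The `f`-vector and the `h`-vector of a finite simplicial complex -/

namespace PreAbstractSimplicialComplex

variable {ι : Type*}

/-- `dim K + 1`, that is, the largest number of vertices of a face of a finite complex `K`
(`0` if the empty face is the only face). -/
noncomputable def dimAddOne (K : PreAbstractSimplicialComplex ι) : ℕ :=
  sSup (Finset.card '' K.faces)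

/-- `K.fVector m` is `f_{m-1}(K)`, the number of faces of `K` with `m` vertices. The empty face,
which Mathlib does not list among the faces, gives `f_{-1}(K) = 1`. -/
noncomputable def fVector (K : PreAbstractSimplicialComplex ι) (m : ℕ) : ℕ :=
  if m = 0 then 1 else Set.ncard {s | s ∈ K.faces ∧ s.card = m}

/-- The entry `h_s(K) = ∑_{i=0}^{s} (-1)^{s-i} C(d+1-i, d+1-s) f_{i-1}(K)` of the `h`-vector of a
`d`-dimensional complex `K`; it is meant for `0 ≤ s ≤ d+1`. -/
noncomputable def hVector (K : PreAbstractSimplicialComplex ι) (s : ℕ) : ℤ :=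
  ∑ i ∈ Finset.range (s + 1),
    (-1) ^ (s - i) * ((K.dimAddOne - i).choose (K.dimAddOne - s) : ℤ) * (K.fVector i : ℤ)

end PreAbstractSimplicialComplex

/-! ### The edgewise subdivision. Coordinates and positions are counted from `0`. -/

namespace EdgewiseSubdivision

/-- The lattice points `0 ≤ v₁ ≤ v₂ ≤ ⋯ ≤ v_{k-1} ≤ q` of the simplex `R_{k,q}`. -/
def vertexSet (k q : ℕ) : Set (Fin (k - 1) → ℤ) :=
  {v | Monotone v ∧ ∀ i, 0 ≤ v i ∧ v i ≤ q}

/-- The permutation `π = π₁ π₂ … π_{k-1}` (a word, `π p` being the letter at position `p`) is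
consistent with `v` if `i` stands before `i + 1` in `π` whenever `v_i = v_{i+1}`. -/
def Consistent {k : ℕ} (v : Fin (k - 1) → ℤ) (π : Equiv.Perm (Fin (k - 1))) : Prop :=
  ∀ i j : Fin (k - 1), (j : ℕ) = i + 1 → v i = v j → π.symm i < π.symm j

/-- `facetVertex v π j` is `v^{(j+1)}`: the vector `v` with the coordinates named by the last `j`
letters of `π` increased by one. -/
def facetVertex {k : ℕ} (v : Fin (k - 1) → ℤ) (π : Equiv.Perm (Fin (k - 1))) (j : Fin k) :
    Fin (k - 1) → ℤ :=
  v + ∑ p ∈ Finset.univ.filter (fun p : Fin (k - 1) => k - 1 ≤ p.val + j.val), Pi.single (π p) 1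

/-- The vertex set `{v^{(1)}, …, v^{(k)}}` of the cell `F(v, π)`. -/
def facet {k : ℕ} (v : Fin (k - 1) → ℤ) (π : Equiv.Perm (Fin (k - 1))) :
    Finset (Fin (k - 1) → ℤ) :=
  Finset.univ.image (facetVertex v π)

/-- The facets of the edgewise subdivision: the cells `F(v, π)` with `v` a vertex and `π` consistent
with `v`, all of whose vertices are vertices of the subdivision. -/
def facets (k q : ℕ) : Set (Finset (Fin (k - 1) → ℤ)) :=
  {F | ∃ v ∈ vertexSet k q, ∃ π : Equiv.Perm (Fin (k - 1)),
    Consistent v π ∧ (facet v π : Set (Fin (k - 1) → ℤ)) ⊆ vertexSet k q ∧ F = facet v π}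

end EdgewiseSubdivision

/-- The edgewise subdivision `T_{k,q}` of the simplex `R_{k,q}`, each cell being given by its set of
vertices: its nonempty faces are the nonempty subsets of its facets. -/
def edgewiseSubdivision (k q : ℕ) : PreAbstractSimplicialComplex (Fin (k - 1) → ℤ) where
  faces := {s | s.Nonempty ∧ ∃ F ∈ EdgewiseSubdivision.facets k q, s ⊆ F}
  isRelLowerSet_faces := by
    rintro s ⟨hs, F, hF, hsF⟩
    exact ⟨hs, fun t hts ht => ⟨ht, F, hF, hts.trans hsF⟩⟩

/-!
The Hilbert series of the Stanley–Reisner ring of a complex of dimension `d - 1` is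
`h(t) / (1 - t) ^ d`, so the `h`-vector is read off from the number of monomials of each degree `n`
supported on a face. The faces of the edgewise subdivision are the sets of lattice points of the
simplex that are totally ordered and contained in a unit cube. A monomial of degree `n` supported on
such a face is a multiset of `n` points, and it is recovered from the sum of its points, because a
lattice point of the `n`-fold dilated simplex splits in exactly one way into `n` points that form a
chain in a unit cube: every coordinate has to be split as evenly as possible. Hence the Hilbert
function at `n` counts the lattice points of a dilated simplex, that is, it equals
`C(n q + k - 1, k - 1)`.
-/

section Multichoose

variable {α : Type*}

theorem range_map_coe_sym (T : Finset α) (m : ℕ) :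
    Set.range (fun N : Sym T m => (N : Multiset T).map (↑)) =
      {M : Multiset α | M.card = m ∧ ∀ a ∈ M, a ∈ T} := by
  ext M
  constructor
  · rintro ⟨N, rfl⟩
    exact ⟨by simp, by simp +contextual⟩
  · rintro ⟨hcard, hM⟩
    lift M to Multiset T using hM
    exact ⟨⟨M, by simpa using hcard⟩, rfl⟩

theorem finite_multisets_card_eq (T : Finset α) (m : ℕ) :
    {M : Multiset α | M.card = m ∧ ∀ a ∈ M, a ∈ T}.Finite := by
  classical
  exact range_map_coe_sym T m ▸ Set.finite_range _

theorem ncard_multisets_card_eq (T : Finset α) (m : ℕ) :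
    {M : Multiset α | M.card = m ∧ ∀ a ∈ M, a ∈ T}.ncard = T.card.multichoose m := by
  rw [← range_map_coe_sym, Set.ncard_range_of_injective, Sym.natCard_sym_eq_multichoose,
    Nat.card_eq_fintype_card, Fintype.card_coe]
  exact (Multiset.map_injective Subtype.val_injective).comp Subtype.val_injective

theorem finite_multisets_toFinset_eq [DecidableEq α] (s : Finset α) (n : ℕ) :
    {M : Multiset α | M.card = n ∧ M.toFinset = s}.Finite := by
  refine (finite_multisets_card_eq s n).subset ?_
  rintro M ⟨hcard, rfl⟩
  exact ⟨hcard, fun _ => Multiset.mem_toFinset.2⟩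

/-- A multiset with support `s` contains every element of `s` at least once; removing one copy of
each leaves an arbitrary multiset on `s`. -/
theorem ncard_multisets_toFinset_eq [DecidableEq α] {s : Finset α} {n : ℕ} (hn : s.card ≤ n) :
    {M : Multiset α | M.card = n ∧ M.toFinset = s}.ncard =
      s.card.multichoose (n - s.card) := by
  rw [← ncard_multisets_card_eq]
  refine (Set.InvOn.bijOn (f' := fun N => N + s.val) (f := fun M => M - s.val)
    ⟨?_, fun N _ => add_tsub_cancel_right N s.val⟩ ?_ ?_).ncard_eq
  · rintro M ⟨-, rfl⟩
    exact tsub_add_cancel_of_le (Multiset.dedup_le M)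
  · rintro M ⟨rfl, rfl⟩
    exact ⟨Multiset.card_sub (Multiset.dedup_le M),
      fun a ha => Multiset.mem_toFinset.2 (Multiset.mem_of_le (Multiset.sub_le_self _ _) ha)⟩
  · rintro N ⟨hcard, hN⟩
    refine ⟨by simp [hcard, hn], ?_⟩
    rw [Multiset.toFinset_add, Finset.val_toFinset, Finset.union_eq_right]
    exact fun a ha => hN a (Multiset.mem_toFinset.1 ha)

theorem multisets_toFinset_eq_empty [DecidableEq α] {s : Finset α} {n : ℕ} (hn : n < s.card) :
    {M : Multiset α | M.card = n ∧ M.toFinset = s} = ∅ := by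
  refine Set.eq_empty_of_forall_notMem ?_
  rintro M ⟨rfl, rfl⟩
  exact hn.not_ge (Multiset.toFinset_card_le M)

end Multichoose

section Sorting

variable {α : Type*} [PartialOrder α]

theorem exists_monotone_map_univ_eq {M : Multiset α} (hM : IsChain (· ≤ ·) {a | a ∈ M}) :
    ∃ f : Fin M.card → α, Monotone f ∧ Finset.univ.val.map f = M := by
  classical
  obtain ⟨r, _, hle⟩ := extend_partialOrder ((· ≤ ·) : α → α → Prop)
  have hlength : (M.sort r).length = M.card := Multiset.length_sort ..
  have hsorted : (M.sort r).SortedLE := by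
    refine List.Pairwise.sortedLE ((Multiset.pairwise_sort M r).imp_of_mem ?_)
    intro a b ha hb hab
    rcases hM.total ((Multiset.mem_sort r).1 ha) ((Multiset.mem_sort r).1 hb) with h | h
    · exact h
    · exact (antisymm hab (hle _ _ h)).le
  refine ⟨fun i => (M.sort r).get (i.cast hlength.symm),
    fun i j hij => hsorted.monotone_get hij, ?_⟩
  rw [Fin.univ_val_map]
  conv_rhs => rw [← Multiset.sort_eq M r, ← List.ofFn_get (M.sort r)]
  exact congrArg _ (List.ofFn_congr hlength (M.sort r).get).symm

theorem map_univ_injOn_monotone (m : ℕ) :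
    Set.InjOn (fun f : Fin m → α => Finset.univ.val.map f) {f | Monotone f} := by
  intro f hf g hg h
  simp only [Fin.univ_val_map] at h
  exact List.ofFn_injective
    ((Multiset.coe_eq_coe.1 h).eq_of_sortedLE hf.sortedLE_ofFn hg.sortedLE_ofFn)

end Sorting

theorem ncard_monotone_mem {α : Type*} [LinearOrder α] (T : Finset α) (m : ℕ) :
    {f : Fin m → α | Monotone f ∧ ∀ i, f i ∈ T}.ncard = T.card.multichoose m := by
  rw [← ncard_multisets_card_eq]
  refine Set.BijOn.ncard_eq (f := fun f => Finset.univ.val.map f)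
    ⟨?_, (map_univ_injOn_monotone m).mono fun f hf => hf.1, ?_⟩
  · rintro f ⟨-, hf⟩
    exact ⟨by simp, by simpa using hf⟩
  · rintro M ⟨rfl, hM⟩
    obtain ⟨f, hf, hfM⟩ := exists_monotone_map_univ_eq (isChain_of_trichotomous {a | a ∈ M})
    refine ⟨f, ⟨hf, fun i => hM _ ?_⟩, hfM⟩
    rw [← hfM]
    exact Multiset.mem_map_of_mem f (Finset.mem_univ i)

section PowerSeries

open PowerSeries

variable {R : Type*} [CommRing R]

theorem coeff_one_sub_X_pow (d n : ℕ) :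
    coeff n ((1 - X : R⟦X⟧) ^ d) = (-1) ^ n * (d.choose n : R) := by
  have h : (1 - X : R⟦X⟧) ^ d =
      rescale (-1) (((1 + Polynomial.X : Polynomial R) ^ d :) : R⟦X⟧) := by
    simp [sub_eq_add_neg]
  rw [h, coeff_rescale, Polynomial.coeff_coe, Polynomial.coeff_one_add_X_pow]

theorem coeff_one_sub_X_pow_mul_mk (d s : ℕ) (a : ℕ → R) :
    coeff s ((1 - X) ^ d * mk a) =
      ∑ j ∈ Finset.range (s + 1), (-1) ^ j * (d.choose j : R) * a (s - j) := by
  simp only [coeff_mul, Finset.Nat.sum_antidiagonal_eq_sum_range_succ_mk, coeff_one_sub_X_pow,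
    coeff_mk]

theorem coeff_X_pow_mul_one_sub_X_pow {m d s : ℕ} (hs : s ≤ d) :
    coeff s (X ^ m * (1 - X : R⟦X⟧) ^ (d - m)) =
      if m ≤ s then (-1) ^ (s - m) * ((d - m).choose (d - s) : R) else 0 := by
  rw [coeff_X_pow_mul']
  split_ifs with hm
  · rw [coeff_one_sub_X_pow, ← Nat.choose_symm (Nat.sub_le_sub_right hs m),
      tsub_tsub_tsub_cancel_right hm]
  · rfl

theorem coeff_invOneSubPow (d n : ℕ) :
    coeff n (invOneSubPow R d : R⟦X⟧) = (d.multichoose n : R) := by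
  cases d with
  | zero => cases n <;> simp [invOneSubPow_zero, coeff_one]
  | succ d =>
    rw [invOneSubPow_val_succ_eq_mk_add_choose, coeff_mk, Nat.multichoose_eq,
      add_right_comm, Nat.add_sub_cancel, Nat.choose_symm_add]

theorem mk_ncard_multisets_toFinset_eq {α : Type*} [DecidableEq α] (s : Finset α) :
    mk (fun n => ({M : Multiset α | M.card = n ∧ M.toFinset = s}.ncard : R)) =
      X ^ s.card * (invOneSubPow R s.card : R⟦X⟧) := by
  ext n
  rw [coeff_mk, coeff_X_pow_mul', coeff_invOneSubPow]
  split_ifs with hn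
  · rw [ncard_multisets_toFinset_eq hn]
  · rw [multisets_toFinset_eq_empty (not_le.1 hn), Set.ncard_empty, Nat.cast_zero]

theorem mk_ncard_multisets_toFinset_mem {α : Type*} [DecidableEq α] (𝓕 : Finset (Finset α)) :
    mk (fun n => ({M : Multiset α | M.card = n ∧ M.toFinset ∈ 𝓕}.ncard : R)) =
      ∑ F ∈ 𝓕, X ^ F.card * (invOneSubPow R F.card : R⟦X⟧) := by
  simp_rw [← mk_ncard_multisets_toFinset_eq]
  ext n
  simp only [map_sum, coeff_mk]
  rw [← Nat.cast_sum, ← finsum_mem_coe_finset, ← 𝓕.finite_toSet.ncard_biUnion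
    fun F _ => finite_multisets_toFinset_eq F n]
  · congr 2
    ext M
    simp
  · refine fun F _ G _ hFG => Set.disjoint_left.2 ?_
    rintro M ⟨-, rfl⟩ ⟨-, rfl⟩
    exact hFG rfl

theorem one_sub_X_pow_mul_mk_ncard_multisets_toFinset_mem {α : Type*} [DecidableEq α]
    {𝓕 : Finset (Finset α)} {d : ℕ} (hd : ∀ F ∈ 𝓕, F.card ≤ d) :
    (1 - X) ^ d * mk (fun n => ({M : Multiset α | M.card = n ∧ M.toFinset ∈ 𝓕}.ncard : R)) =
      ∑ F ∈ 𝓕, X ^ F.card * (1 - X : R⟦X⟧) ^ (d - F.card) := by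
  rw [mk_ncard_multisets_toFinset_mem, Finset.mul_sum]
  refine Finset.sum_congr rfl fun F hF => ?_
  rw [← one_sub_pow_add_mul_invOneSubPow_val_eq_one_sub_pow R (d - F.card) F.card,
    Nat.sub_add_cancel (hd F hF)]
  ring

end PowerSeries

namespace StanleyReisner

variable {ι : Type*} {K : PreAbstractSimplicialComplex ι}

/-- The Hilbert function of the Stanley–Reisner ring of `K`: the number of monomials of degree `n`
whose set of variables is a face of `K`, possibly the empty one. A monomial is encoded as the
multiset of its variables. -/
noncomputable def hilbertFunction [DecidableEq ι] (K : PreAbstractSimplicialComplex ι) (n : ℕ) :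
    ℕ :=
  {M : Multiset ι | M.card = n ∧ (M = 0 ∨ M.toFinset ∈ K.faces)}.ncard

theorem card_le_dimAddOne (hK : K.faces.Finite) {s : Finset ι} (hs : s ∈ K.faces) :
    s.card ≤ K.dimAddOne :=
  le_csSup (hK.image _).bddAbove (Set.mem_image_of_mem _ hs)

theorem fVector_eq_card_filter {𝓕 : Finset (Finset ι)} (h𝓕 : ∀ s, s ∈ 𝓕 ↔ s = ∅ ∨ s ∈ K.faces)
    (m : ℕ) : K.fVector m = (𝓕.filter (·.card = m)).card := by
  rw [PreAbstractSimplicialComplex.fVector]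
  split_ifs with hm
  · rw [eq_comm, Finset.card_eq_one]
    exact ⟨∅, by ext s; simp +contextual [hm, h𝓕]⟩
  · rw [← Set.ncard_coe_finset]
    congr 1
    ext s
    have : s.card = m → s ≠ ∅ := by rintro rfl rfl; exact hm rfl
    simp only [Set.mem_ofPred_eq, Finset.coe_filter, h𝓕]
    tauto

open PowerSeries in
theorem hVector_eq_coeff {𝓕 : Finset (Finset ι)} (h𝓕 : ∀ s, s ∈ 𝓕 ↔ s = ∅ ∨ s ∈ K.faces) {s : ℕ}
    (hs : s ≤ K.dimAddOne) :
    K.hVector s = coeff s (∑ F ∈ 𝓕, X ^ F.card * (1 - X : ℤ⟦X⟧) ^ (K.dimAddOne - F.card)) := by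
  simp only [PreAbstractSimplicialComplex.hVector, fVector_eq_card_filter h𝓕, map_sum,
    coeff_X_pow_mul_one_sub_X_pow hs, Finset.card_filter, Nat.cast_sum, Finset.mul_sum]
  rw [Finset.sum_comm]
  refine Finset.sum_congr rfl fun F _ => ?_
  simp

theorem hVector_eq_sum_hilbertFunction [DecidableEq ι] (hK : K.faces.Finite) {s : ℕ}
    (hs : s ≤ K.dimAddOne) :
    K.hVector s = ∑ j ∈ Finset.range (s + 1),
      (-1) ^ j * (K.dimAddOne.choose j : ℤ) * (hilbertFunction K (s - j) : ℤ) := by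
  let 𝓕 := insert ∅ hK.toFinset
  have h𝓕 (F : Finset ι) : F ∈ 𝓕 ↔ F = ∅ ∨ F ∈ K.faces := by simp [𝓕]
  have hcard : ∀ F ∈ 𝓕, F.card ≤ K.dimAddOne := by
    intro F hF
    rcases (h𝓕 F).1 hF with rfl | hF
    · exact Nat.zero_le _
    · exact card_le_dimAddOne hK hF
  rw [hVector_eq_coeff h𝓕 hs, ← one_sub_X_pow_mul_mk_ncard_multisets_toFinset_mem hcard,
    coeff_one_sub_X_pow_mul_mk]
  simp only [hilbertFunction, h𝓕, Multiset.toFinset_eq_empty]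

end StanleyReisner

section Balanced

theorem eq_sum_add_ediv_of_monotone {n : ℕ} {a : Fin n → ℤ} (ha : Monotone a)
    (h : ∀ i j, a j ≤ a i + 1) (j : Fin n) : a j = (∑ i, a i + j) / n := by
  have hn : (0 : ℤ) < n := by exact_mod_cast j.pos
  have hlower : ∑ i, (a j - if i < j then 1 else 0) ≤ ∑ i, a i := by
    refine Finset.sum_le_sum fun i _ => ?_
    split_ifs with hij
    · linarith [h i j]
    · linarith [ha (not_lt.1 hij)]
  have hupper : ∑ i, a i ≤ ∑ i, (a j + if j < i then 1 else 0) := by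
    refine Finset.sum_le_sum fun i _ => ?_
    split_ifs with hij
    · linarith [h j i]
    · linarith [ha (not_lt.1 hij)]
  simp only [Finset.sum_sub_distrib, Finset.sum_add_distrib, Finset.sum_const, Finset.card_univ,
    Fintype.card_fin, nsmul_eq_mul, Finset.sum_boole, Finset.filter_gt_eq_Iio,
    Finset.filter_lt_eq_Ioi, Fin.card_Iio, Fin.card_Ioi] at hlower hupper
  rw [eq_comm, Int.ediv_eq_iff_of_pos hn, mul_comm]
  constructor <;> omega

theorem sum_add_ediv {n : ℕ} (hn : n ≠ 0) (x : ℤ) : ∑ j : Fin n, (x + j) / (n : ℤ) = x := by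
  have hn' : (n : ℤ) ≠ 0 := by exact_mod_cast hn
  have hpos : (0 : ℤ) < n := by omega
  obtain ⟨r, hr⟩ := Int.eq_ofNat_of_zero_le (Int.emod_nonneg x hn')
  have hrn : r < n := by exact_mod_cast hr ▸ Int.emod_lt_of_pos x hpos
  have hquot (j : ℕ) (hj : j < n) : (x + j) / (n : ℤ) = x / n + if n - r ≤ j then 1 else 0 := by
    rw [Int.ediv_eq_iff_of_pos hpos, add_mul]
    have := Int.ediv_mul_add_emod x n
    split_ifs <;> omega
  rw [Fin.sum_univ_eq_sum_range (fun j => (x + j) / (n : ℤ)),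
    Finset.sum_congr rfl fun j hj => hquot j (Finset.mem_range.1 hj),
    Finset.sum_add_distrib, Finset.sum_boole,
    show (Finset.range n).filter (n - r ≤ ·) = Finset.Ico (n - r) n by ext; simp [and_comm]]
  simp only [Finset.sum_const, Finset.card_range, nsmul_eq_mul, Nat.card_Ico]
  rw [Nat.sub_sub_self hrn.le, ← hr]
  exact Int.mul_ediv_add_emod x n

/-- Sets of integer points that are pairwise comparable and lie in a common unit cube. For points of
`vertexSet k q` these turn out to be the faces of the edgewise subdivision. -/
structure IsUnitChain {ι : Type*} (s : Set (ι → ℤ)) : Prop where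
  isChain : IsChain (· ≤ ·) s
  le_add_one : ∀ ⦃a⦄, a ∈ s → ∀ ⦃b⦄, b ∈ s → a ≤ b + 1

/-- The multiset of the `n` integer points obtained by splitting `x` as evenly as possible: in every
coordinate, `x c` is the sum of the integers `⌊(x c + j) / n⌋`, `0 ≤ j < n`, which differ by at most
one and increase with `j`. -/
def balancedParts {ι : Type*} (n : ℕ) (x : ι → ℤ) : Multiset (ι → ℤ) :=
  Finset.univ.val.map fun (j : Fin n) c => (x c + j) / (n : ℤ)

variable {ι : Type*}

theorem IsUnitChain.mono {s t : Set (ι → ℤ)} (hst : s ⊆ t) (ht : IsUnitChain t) : IsUnitChain s :=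
  ⟨ht.isChain.mono hst, fun _ ha _ hb => ht.le_add_one (hst ha) (hst hb)⟩

theorem isUnitChain_of_subsingleton {s : Set (ι → ℤ)} (hs : s.Subsingleton) : IsUnitChain s :=
  ⟨hs.isChain, fun _ ha _ hb _ => by simp [hs ha hb]⟩

theorem mem_balancedParts {n : ℕ} {x a : ι → ℤ} :
    a ∈ balancedParts n x ↔ ∃ j : Fin n, (fun c => (x c + j) / (n : ℤ)) = a := by
  simp [balancedParts, eq_comm]

theorem card_balancedParts (n : ℕ) (x : ι → ℤ) : (balancedParts n x).card = n := by
  simp [balancedParts]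

theorem sum_balancedParts {n : ℕ} (hn : n ≠ 0) (x : ι → ℤ) : (balancedParts n x).sum = x := by
  change ∑ j : Fin n, (fun c => (x c + j) / (n : ℤ)) = x
  ext c
  rw [Finset.sum_apply, sum_add_ediv hn]

theorem isUnitChain_balancedParts (n : ℕ) (x : ι → ℤ) :
    IsUnitChain {a | a ∈ balancedParts n x} := by
  have hmono : Monotone fun (j : Fin n) c => (x c + j) / (n : ℤ) := by
    intro i j hij c
    have : (i : ℤ) ≤ j := by exact_mod_cast hij
    exact Int.ediv_le_ediv (by exact_mod_cast i.pos) (by omega)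
  simp only [mem_balancedParts]
  refine ⟨hmono.isChain_range, ?_⟩
  rintro _ ⟨i, rfl⟩ _ ⟨j, rfl⟩ c
  have hn : (0 : ℤ) < n := by exact_mod_cast i.pos
  calc (x c + i) / (n : ℤ) ≤ (x c + j + n) / (n : ℤ) := Int.ediv_le_ediv hn (by omega)
    _ = (x c + j) / (n : ℤ) + 1 := by
      rw [Int.add_ediv_of_dvd_right dvd_rfl, Int.ediv_self hn.ne']

theorem IsUnitChain.balancedParts_sum {M : Multiset (ι → ℤ)} (hM : IsUnitChain {a | a ∈ M}) :
    balancedParts M.card M.sum = M := by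
  obtain ⟨f, hf, hfM⟩ := exists_monotone_map_univ_eq hM.isChain
  have hmem (j) : f j ∈ M := hfM ▸ Multiset.mem_map_of_mem f (Finset.mem_univ j)
  have hsum : M.sum = ∑ j, f j := congrArg Multiset.sum hfM.symm
  conv_rhs => rw [← hfM]
  refine Multiset.map_congr rfl fun j _ => funext fun c => ?_
  rw [hsum, Finset.sum_apply]
  exact (eq_sum_add_ediv_of_monotone (fun _ _ hij => hf hij c)
    (fun i j => hM.le_add_one (hmem j) (hmem i) c) j).symm

end Balanced

namespace EdgewiseSubdivision

variable {k q n : ℕ}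

section DilatedSimplex

theorem ncard_vertexSet (k N : ℕ) : (vertexSet k N).ncard = (N + (k - 1)).choose (k - 1) := by
  have h := ncard_monotone_mem (Finset.Icc (0 : ℤ) N) (k - 1)
  simp only [Finset.mem_Icc, Int.card_Icc, sub_zero, Nat.multichoose_eq] at h
  rw [vertexSet, h]
  congr 1
  omega

theorem zero_mem_vertexSet (k q : ℕ) : 0 ∈ vertexSet k q :=
  ⟨monotone_const, fun _ => ⟨le_rfl, Nat.cast_nonneg q⟩⟩

theorem add_mem_vertexSet {m : ℕ} {a b : Fin (k - 1) → ℤ} (ha : a ∈ vertexSet k m)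
    (hb : b ∈ vertexSet k n) : a + b ∈ vertexSet k (m + n) := by
  refine ⟨ha.1.add hb.1, fun i => ?_⟩
  have := ha.2 i
  have := hb.2 i
  simp only [Pi.add_apply, Nat.cast_add]
  omega

theorem sum_mem_vertexSet {M : Multiset (Fin (k - 1) → ℤ)} (hM : ∀ a ∈ M, a ∈ vertexSet k q) :
    M.sum ∈ vertexSet k (M.card * q) := by
  induction M using Multiset.induction_on with
  | empty => exact zero_mem_vertexSet k _
  | cons a M ih =>
    rw [Multiset.forall_mem_cons] at hM
    rw [Multiset.sum_cons, Multiset.card_cons, add_one_mul, add_comm (_ * q)]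
    exact add_mem_vertexSet hM.1 (ih hM.2)

theorem mem_vertexSet_of_mem_balancedParts {x a : Fin (k - 1) → ℤ}
    (hx : x ∈ vertexSet k (n * q)) (ha : a ∈ balancedParts n x) : a ∈ vertexSet k q := by
  obtain ⟨j, rfl⟩ := mem_balancedParts.1 ha
  have hn : (0 : ℤ) < n := by exact_mod_cast j.pos
  refine ⟨fun c c' hcc' => Int.ediv_le_ediv hn (by linarith [hx.1 hcc']), fun c => ?_⟩
  obtain ⟨hlower, hupper⟩ := hx.2 c
  refine ⟨Int.ediv_nonneg (by omega) hn.le, ?_⟩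
  rw [← Int.lt_add_one_iff, Int.ediv_lt_iff_lt_mul hn]
  push_cast at hupper
  linarith [show (j : ℤ) < n by exact_mod_cast j.isLt]

theorem bijOn_sum_unitChain (k q n : ℕ) :
    Set.BijOn Multiset.sum
      {M : Multiset (Fin (k - 1) → ℤ) |
        M.card = n ∧ {a | a ∈ M} ⊆ vertexSet k q ∧ IsUnitChain {a | a ∈ M}}
      (vertexSet k (n * q)) := by
  refine Set.InvOn.bijOn (f' := balancedParts n) ⟨?_, ?_⟩ ?_ ?_
  · rintro M ⟨rfl, -, hM⟩
    exact hM.balancedParts_sum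
  · intro x hx
    rcases eq_or_ne n 0 with rfl | hn
    · ext c
      have := hx.2 c
      simp only [zero_mul, Nat.cast_zero] at this
      exact le_antisymm this.1 this.2
    · exact sum_balancedParts hn x
  · rintro M ⟨rfl, hM, -⟩
    exact sum_mem_vertexSet hM
  · exact fun x hx => ⟨card_balancedParts n x,
      fun a ha => mem_vertexSet_of_mem_balancedParts hx ha, isUnitChain_balancedParts n x⟩

end DilatedSimplex

section Facets

variable {v : Fin (k - 1) → ℤ} {π : Equiv.Perm (Fin (k - 1))}

theorem facetVertex_apply (v : Fin (k - 1) → ℤ) (π : Equiv.Perm (Fin (k - 1))) (j : Fin k)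
    (c : Fin (k - 1)) :
    facetVertex v π j c = v c + if k - 1 ≤ (π.symm c : ℕ) + j then 1 else 0 := by
  simp only [facetVertex, Pi.add_apply, Finset.sum_apply, Pi.single_apply, ← π.symm_apply_eq,
    Finset.sum_ite_eq, Finset.mem_filter, Finset.mem_univ, true_and]

theorem facetVertex_strictMono (v : Fin (k - 1) → ℤ) (π : Equiv.Perm (Fin (k - 1))) :
    StrictMono (facetVertex v π) := by
  intro i j hij
  rw [Fin.lt_def] at hij
  rw [Pi.lt_def]
  refine ⟨fun c => ?_, π ⟨k - 1 - j, by omega⟩, ?_⟩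
  · simp only [facetVertex_apply]
    split_ifs <;> omega
  · simp only [facetVertex_apply, Equiv.symm_apply_apply]
    rw [if_neg (by omega), if_pos (by omega)]
    omega

theorem coe_facet (v : Fin (k - 1) → ℤ) (π : Equiv.Perm (Fin (k - 1))) :
    (facet v π : Set (Fin (k - 1) → ℤ)) = Set.range (facetVertex v π) := by
  rw [facet, Finset.coe_image, Finset.coe_univ, Set.image_univ]

theorem card_facet (v : Fin (k - 1) → ℤ) (π : Equiv.Perm (Fin (k - 1))) :
    (facet v π).card = k := by
  rw [facet, Finset.card_image_of_injective _ (facetVertex_strictMono v π).injective,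
    Finset.card_univ, Fintype.card_fin]

theorem isUnitChain_facet (v : Fin (k - 1) → ℤ) (π : Equiv.Perm (Fin (k - 1))) :
    IsUnitChain (facet v π : Set (Fin (k - 1) → ℤ)) := by
  rw [coe_facet]
  refine ⟨(facetVertex_strictMono v π).monotone.isChain_range, ?_⟩
  rintro _ ⟨i, rfl⟩ _ ⟨j, rfl⟩ c
  simp only [Pi.add_apply, Pi.one_apply, facetVertex_apply]
  split_ifs <;> omega

theorem Consistent.monotone_facetVertex (hπ : Consistent v π) (hv : Monotone v) (j : Fin k) :
    Monotone (facetVertex v π j) := by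
  rw [monotone_iff_forall_covBy]
  intro c c' hcc'
  have hsucc : (c' : ℕ) = c + 1 := (Nat.covBy_iff_add_one_eq.1 (Fin.covBy_iff.1 hcc')).symm
  simp only [facetVertex_apply]
  rcases (hv hcc'.le).lt_or_eq with hlt | heq
  · split_ifs <;> omega
  · have := Fin.lt_def.1 (hπ c c' hsucc heq)
    split_ifs <;> omega

theorem Consistent.facet_subset_vertexSet (hπ : Consistent v π) (hv : Monotone v)
    (hnonneg : 0 ≤ v) (hlt : ∀ c, v c < q) :
    (facet v π : Set (Fin (k - 1) → ℤ)) ⊆ vertexSet k q := by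
  rw [coe_facet]
  rintro _ ⟨j, rfl⟩
  refine ⟨hπ.monotone_facetVertex hv j, fun c => ?_⟩
  have : 0 ≤ v c := hnonneg c
  have := hlt c
  rw [facetVertex_apply]
  split_ifs <;> omega

theorem exists_forall_mem_iff_of_isUpperSet {n : ℕ} {U : Set (Fin n)} (hU : IsUpperSet U) :
    ∃ j ≤ n, ∀ p : Fin n, p ∈ U ↔ n ≤ p + j := by
  rcases hU.eq_empty_or_Ici with rfl | ⟨a, rfl⟩
  · exact ⟨0, n.zero_le, fun p => by simp⟩
  · exact ⟨n - a, n.sub_le a, fun p => by rw [Set.mem_Ici, Fin.le_def]; omega⟩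

theorem mem_facet_of_isUpperSet (hk : 1 ≤ k) {u : Fin (k - 1) → ℤ} (hvu : v ≤ u) (huv : u ≤ v + 1)
    (hupper : IsUpperSet {p | v (π p) < u (π p)}) : u ∈ facet v π := by
  obtain ⟨j, hj, hmem⟩ := exists_forall_mem_iff_of_isUpperSet hupper
  refine Finset.mem_image.2 ⟨⟨j, by omega⟩, Finset.mem_univ _, funext fun c => ?_⟩
  have hc := hmem (π.symm c)
  rw [Set.mem_ofPred_eq, π.apply_symm_apply] at hc
  have : v c ≤ u c := hvu c
  have : u c ≤ v c + 1 := huv c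
  simp only [facetVertex_apply]
  split_ifs <;> omega

end Facets

section IncrementOrder

/-- The number of points of `s` whose coordinate `c` exceeds that of `v`. In a chain starting at `v`
it is large when the coordinate is incremented early. -/
def incrementCount {ι : Type*} (s : Finset (ι → ℤ)) (v : ι → ℤ) (c : ι) : ℕ :=
  (s.filter fun u => v c < u c).card

/-- The permutation `π` for which a unit chain `s` above `v` lies in `facet v π`. As `facetVertex`
increments the last letters first, the coordinates are sorted by `incrementCount`; the sorting is
stable, which is what makes the permutation consistent with `v`. -/
def incrementOrder (s : Finset (Fin n → ℤ)) (v : Fin n → ℤ) : Equiv.Perm (Fin n) :=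
  Tuple.sort (incrementCount s v)

theorem symm_sort_lt_symm_sort {α : Type*} [LinearOrder α] {f : Fin n → α} {i j : Fin n}
    (hij : i < j) (hf : f i ≤ f j) : (Tuple.sort f).symm i < (Tuple.sort f).symm j := by
  obtain ⟨hmono, hstable⟩ := Tuple.eq_sort_iff.1 (rfl : Tuple.sort f = Tuple.sort f)
  by_contra! hji
  have hne : (Tuple.sort f).symm j ≠ (Tuple.sort f).symm i := by simpa using hij.ne'
  have hle : f j ≤ f i := by simpa using hmono hji
  have hlt := hstable _ _ (hji.lt_of_ne hne) (by simpa using le_antisymm hle hf)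
  simp only [Equiv.apply_symm_apply] at hlt
  exact hij.asymm hlt

theorem consistent_incrementOrder {s : Finset (Fin (k - 1) → ℤ)} {v : Fin (k - 1) → ℤ}
    (hs : ∀ u ∈ s, Monotone u) : Consistent v (incrementOrder s v) := by
  intro i j hij hv
  have hlt : i < j := Fin.lt_def.2 (by omega)
  refine symm_sort_lt_symm_sort hlt
    (Finset.card_le_card (Finset.monotone_filter_right s fun u hu hui => ?_))
  exact hv ▸ hui.trans_le (hs u hu hlt.le)

theorem lt_of_incrementCount_le {ι : Type*} {s : Finset (ι → ℤ)} {v u : ι → ℤ} {c c' : ι}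
    (hs : IsChain (· ≤ ·) (s : Set (ι → ℤ)))
    (hcount : incrementCount s v c ≤ incrementCount s v c') (hu : u ∈ s) (huc : v c < u c) :
    v c' < u c' := by
  by_contra huc'
  refine hcount.not_gt (Finset.card_lt_card (Finset.ssubset_iff_of_subset ?_ |>.2
    ⟨u, Finset.mem_filter.2 ⟨hu, huc⟩, fun h => huc' (Finset.mem_filter.1 h).2⟩))
  refine Finset.monotone_filter_right s fun w hw hwc' => ?_
  have huw : u ≤ w := (hs.total hu hw).resolve_right fun h => huc' (hwc'.trans_le (h c'))
  exact huc.trans_le (huw c)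

theorem subset_facet_incrementOrder (hk : 1 ≤ k) {s : Finset (Fin (k - 1) → ℤ)}
    {v : Fin (k - 1) → ℤ} (hs : IsChain (· ≤ ·) (s : Set (Fin (k - 1) → ℤ)))
    (hv : ∀ u ∈ s, v ≤ u ∧ u ≤ v + 1) : s ⊆ facet v (incrementOrder s v) :=
  fun u hu => mem_facet_of_isUpperSet hk (hv u hu).1 (hv u hu).2 fun _ _ hpp' =>
    lt_of_incrementCount_le hs (Tuple.monotone_sort (incrementCount s v) hpp') hu

end IncrementOrder

section Faces

/-- The base point is the minimum of the chain, except that a coordinate equal to `q` is lowered to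
`q - 1` so that it can still be incremented. -/
theorem exists_base_of_isUnitChain (hq : 1 ≤ q) {s : Finset (Fin (k - 1) → ℤ)} (hne : s.Nonempty)
    (hvertex : (s : Set (Fin (k - 1) → ℤ)) ⊆ vertexSet k q)
    (hs : IsUnitChain (s : Set (Fin (k - 1) → ℤ))) :
    ∃ v : Fin (k - 1) → ℤ, Monotone v ∧ 0 ≤ v ∧ (∀ c, v c < q) ∧ ∀ u ∈ s, v ≤ u ∧ u ≤ v + 1 := by
  obtain ⟨m, hm, hmin⟩ := s.exists_minimal hne
  have hle (u) (hu : u ∈ s) : m ≤ u := (hs.isChain.total hm hu).elim id (hmin hu)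
  obtain ⟨hmono, hbounds⟩ := hvertex hm
  refine ⟨fun c => min (m c) (q - 1), hmono.min monotone_const, fun c => ?_,
    fun c => (min_le_right _ _).trans_lt (sub_one_lt _),
    fun u hu => ⟨fun c => (min_le_left _ _).trans (hle u hu c), fun c => ?_⟩⟩
  · have := hbounds c
    simp only [Pi.zero_apply]
    omega
  · have : u c ≤ m c + 1 := hs.le_add_one hu hm c
    have := (hvertex hu).2 c
    simp only [Pi.add_apply, Pi.one_apply]
    omega

theorem exists_facet_of_isUnitChain (hk : 1 ≤ k) (hq : 1 ≤ q) {s : Finset (Fin (k - 1) → ℤ)}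
    (hne : s.Nonempty) (hvertex : (s : Set (Fin (k - 1) → ℤ)) ⊆ vertexSet k q)
    (hs : IsUnitChain (s : Set (Fin (k - 1) → ℤ))) : ∃ F ∈ facets k q, s ⊆ F := by
  obtain ⟨v, hmono, hnonneg, hlt, hv⟩ := exists_base_of_isUnitChain hq hne hvertex hs
  have hπ : Consistent v (incrementOrder s v) :=
    consistent_incrementOrder fun u hu => (hvertex hu).1
  exact ⟨_, ⟨v, ⟨hmono, fun c => ⟨hnonneg c, (hlt c).le⟩⟩, _, hπ,
    hπ.facet_subset_vertexSet hmono hnonneg hlt, rfl⟩,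
    subset_facet_incrementOrder hk hs.isChain hv⟩

theorem mem_faces_iff (hk : 1 ≤ k) (hq : 1 ≤ q) {s : Finset (Fin (k - 1) → ℤ)} :
    s ∈ (edgewiseSubdivision k q).faces ↔
      s.Nonempty ∧ (s : Set (Fin (k - 1) → ℤ)) ⊆ vertexSet k q ∧
        IsUnitChain (s : Set (Fin (k - 1) → ℤ)) := by
  constructor
  · rintro ⟨hne, F, ⟨v, -, π, -, hF, rfl⟩, hsF⟩
    rw [← Finset.coe_subset] at hsF
    exact ⟨hne, hsF.trans hF, (isUnitChain_facet v π).mono hsF⟩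
  · rintro ⟨hne, hvertex, hs⟩
    exact ⟨hne, exists_facet_of_isUnitChain hk hq hne hvertex hs⟩

theorem finite_vertexSet (k q : ℕ) : (vertexSet k q).Finite :=
  (Set.finite_Icc (0 : Fin (k - 1) → ℤ) fun _ => (q : ℤ)).subset
    fun _ hv => ⟨fun c => (hv.2 c).1, fun c => (hv.2 c).2⟩

theorem finite_faces (k q : ℕ) : (edgewiseSubdivision k q).faces.Finite := by
  refine ((finite_vertexSet k q).powerset.preimage Finset.coe_injective.injOn).subset ?_
  rintro s ⟨-, F, ⟨v, -, π, -, hF, rfl⟩, hsF⟩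
  exact (Finset.coe_subset.2 hsF).trans hF

theorem dimAddOne_edgewiseSubdivision (hk : 1 ≤ k) (hq : 1 ≤ q) :
    (edgewiseSubdivision k q).dimAddOne = k := by
  refine IsGreatest.csSup_eq ⟨?_, ?_⟩
  · obtain ⟨_, ⟨v, hv, π, hπ, hF, rfl⟩, -⟩ := exists_facet_of_isUnitChain (q := q) hk hq
      (Finset.singleton_nonempty 0) (by simpa using zero_mem_vertexSet k q)
      (isUnitChain_of_subsingleton (by simp))
    exact ⟨facet v π, ⟨Finset.card_pos.1 (by rwa [card_facet]), _, ⟨v, hv, π, hπ, hF, rfl⟩,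
      subset_rfl⟩, card_facet v π⟩
  · rintro _ ⟨s, ⟨-, _, ⟨v, -, π, -, -, rfl⟩, hsF⟩, rfl⟩
    exact (Finset.card_le_card hsF).trans_eq (card_facet v π)

theorem hilbertFunction_edgewiseSubdivision (hk : 1 ≤ k) (hq : 1 ≤ q) (n : ℕ) :
    StanleyReisner.hilbertFunction (edgewiseSubdivision k q) n =
      (n * q + (k - 1)).choose (k - 1) := by
  rw [← ncard_vertexSet, ← (bijOn_sum_unitChain k q n).ncard_eq, StanleyReisner.hilbertFunction]
  congr 1
  ext M
  refine and_congr_right fun _ => ?_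
  rw [mem_faces_iff hk hq, Multiset.toFinset_nonempty]
  have hcoe : (M.toFinset : Set (Fin (k - 1) → ℤ)) = {a | a ∈ M} := by simp [Set.ext_iff]
  rw [hcoe]
  rcases eq_or_ne M 0 with rfl | hM
  · simp [isUnitChain_of_subsingleton Set.subsingleton_empty]
  · simp [hM]

end Faces

end EdgewiseSubdivision

theorem mainTheorem2 (k q : ℕ) (hk : 1 ≤ k) (hq : 1 ≤ q) (i : ℕ) (hi : i ≤ k) :
    (edgewiseSubdivision k q).hVector i =
      ∑ j ∈ Finset.range (i + 1),
        (-1 : ℤ) ^ j * (k.choose j : ℤ) * (((i - j) * q + k - 1).choose (k - 1) : ℤ) := by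
  have hdim := EdgewiseSubdivision.dimAddOne_edgewiseSubdivision hk hq
  rw [StanleyReisner.hVector_eq_sum_hilbertFunction (EdgewiseSubdivision.finite_faces k q)
    (hdim.symm ▸ hi), hdim]
  simp only [EdgewiseSubdivision.hilbertFunction_edgewiseSubdivision hk hq, Nat.add_sub_assoc hk]
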